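/- Let $\mathbb K$ be a field of characteristic $0$. A $\mathbb K$-algebra is weakly associative if its associator $\mathcal A(x,y,z)=x(yz)-(xy)z$ satisfies $\mathcal A(x,y,z)+\mathcal A(y,z,x)-\mathcal A(y,x,z)=0$ for all $x,y,z$. Let $A=\bigoplus_{k\ge 0}A_k$ be the free unital weakly associative $\mathbb K$-algebra on one generator $X$, graded by the number of occurrences of $X$ (so $A_0=\mathbb K$). Let $C_n=A\otimes A^{\otimes n}$, graded by total degree, and write $C_n^k$ for its component of degree $k$. Put $$b_1(m,a)=ma-am,\qquad b_2(m,a,b)=(ma,b)-(m,ab)+(bm,a),$$ $$b_3(m,a,b,c)=(ma,b,c)-(m,ab,c)+(m,a,bc)-(cm,a,b),$$ $$b_1^{WA}=b_1,\qquad b_2^{WA}(a_1,a_2,a_3)=b_2(a_1,a_2,a_3)+b_2(a_2,a_3,a_1)-b_2(a_2,a_1,a_3),$$ $$b_3^{WA}(a_1,a_2,a_3,a_4)=b_3(a_1,a_2,a_3,a_4)+b_3(a_1,a_4,a_3,a_2).$$ **Proposition.** On $A$ one has $b_1^{WA}b_2^{WA}=0$, $b_2^{WA}b_3^{WA}=0$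 and $b_2^{WA}=b_2$. Let $H_0=A/\operatorname{Im} b_1^{WA}$, $H_1=\ker b_1^{WA}/\operatorname{Im} b_2^{WA}$, $H_2=\ker b_2^{WA}/\operatorname{Im} b_3^{WA}$, and let $H_n^k$ be the component of $H_n$ of degree $k$. Then: 1. the projection $A\to H_0$ is an isomorphism; 2. $\dim H_1^0=0$ and $\dim H_1^{k+1}=\dim A_{k}$ for all $k\ge 0$; in particular $\dim H_1^1=\dim H_1^2=\dim H_1^3=\dim H_1^4=1$, $\dim H_1^5=2$, $\dim H_1^6=3$; 3. $\dim H_2^0=0$, $\dim H_2^1=1$, $\dim H_2^2=2$. Consequently $A$ is not Koszul, in the sense that the homology of this complex is not trivial outside degree $0$: however $C_3\to C_2\to C_1\to C_0$ (with the boundaries $b_3^{WA},b_2^{WA},b_1^{WA}$) is continued by terms of degree $\ge 4$ to a chain complex of $\mathbb K$-vector spaces, the homology of that complex is not zero in all positive degrees. In fact its homology in degree $2$ is never zero. -/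

import Mathlib

open scoped TensorProduct

noncomputable section

universe u v

namespace WeakAssoc

section Identity

/-- The associator `a * (b * c) - (a * b) * c`. -/
def assoc {A : Type*} [NonUnitalNonAssocRing A] (a b c : A) : A :=
  a * (b * c) - (a * b) * c

/-- The identity `𝒜(a, b, c) + 𝒜(b, c, a) - 𝒜(b, a, c) = 0` for all `a, b, c`. -/
def IsWeaklyAssociative (A : Type*) [NonUnitalNonAssocRing A] : Prop :=
  ∀ a b c : A, assoc a b c + assoc b c a - assoc b a c = 0

end Identity

section FreeAlgebra

variable (K : Type u) [Field K] (X : Type v)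

/-- The free unital nonassociative `K`-algebra on the set `X`: the vector space on the empty word
`1` and all nonempty bracketed words in `X`. -/
abbrev FreeNonAssoc : Type (max u v) := MonoidAlgebra K (WithOne (FreeMagma X))

/-- The generating relations of weak associativity. -/
def Rel (p q : FreeNonAssoc K X) : Prop :=
  ∃ a b c : FreeNonAssoc K X, p = assoc a b c + assoc b c a - assoc b a c ∧ q = 0

/-- The free (unital) weakly associative `K`-algebra on the set `X`: the quotient of the free
unital nonassociative algebra by the smallest congruence that contains the relations. -/
def FreeWA : Type (max u v) := (ringConGen (Rel K X)).Quotient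

instance : NonAssocRing (FreeWA K X) :=
  inferInstanceAs (NonAssocRing (ringConGen (Rel K X)).Quotient)

instance : SMul K (FreeWA K X) :=
  inferInstanceAs (SMul K (ringConGen (Rel K X)).Quotient)

/-- The quotient map. -/
def mk : FreeNonAssoc K X →+* FreeWA K X := (ringConGen (Rel K X)).mk'

theorem mk_surjective : Function.Surjective (mk K X) := Quotient.mk''_surjective

theorem smul_mk (r : K) (p : FreeNonAssoc K X) : r • mk K X p = mk K X (r • p) := rfl

instance : Module K (FreeWA K X) :=
  Function.Surjective.module K (mk K X).toAddMonoidHom (mk_surjective K X) fun _ _ => rfl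

instance : IsScalarTower K (FreeWA K X) (FreeWA K X) where
  smul_assoc r x y := by
    obtain ⟨p, rfl⟩ := mk_surjective K X x
    obtain ⟨q, rfl⟩ := mk_surjective K X y
    simp only [smul_eq_mul, smul_mk, ← map_mul, smul_mul_assoc]

instance : SMulCommClass K (FreeWA K X) (FreeWA K X) where
  smul_comm r x y := by
    obtain ⟨p, rfl⟩ := mk_surjective K X x
    obtain ⟨q, rfl⟩ := mk_surjective K X y
    simp only [smul_eq_mul, smul_mk, ← map_mul, mul_smul_comm]

theorem freeWA_isWeaklyAssociative : IsWeaklyAssociative (FreeWA K X) := by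
  intro x y z
  obtain ⟨a, rfl⟩ := mk_surjective K X x
  obtain ⟨b, rfl⟩ := mk_surjective K X y
  obtain ⟨c, rfl⟩ := mk_surjective K X z
  have h : mk K X (assoc a b c + assoc b c a - assoc b a c) = mk K X 0 :=
    (RingCon.eq (ringConGen (Rel K X))).2 (RingConGen.Rel.of _ _ ⟨a, b, c, rfl, rfl⟩)
  simpa only [assoc, map_add, map_sub, map_mul, map_zero] using h

/-- The class in the free weakly associative algebra of a bracketed word (or of the empty word). -/
def word (w : WithOne (FreeMagma X)) : FreeWA K X :=
  mk K X (MonoidAlgebra.of K (WithOne (FreeMagma X)) w)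

variable {X} in
/-- The number of letters of a bracketed word; the empty word has length `0`. -/
def wordLength : WithOne (FreeMagma X) → ℕ :=
  WithOne.recOneCoe 0 FreeMagma.length

/-- The homogeneous component of degree `k`, spanned by the classes of words of length `k`. -/
def degreePart (k : ℕ) : Submodule K (FreeWA K X) :=
  Submodule.span K {a | ∃ w, wordLength w = k ∧ word K X w = a}

end FreeAlgebra

section Permutations

variable (K : Type u) [Field K] (A : Type v) [NonAssocRing A] [Module K A]

/-! The chain spaces are `C₀ = A`, `C₁ = A ⊗ A`, `C₂ = A ⊗ A ⊗ A`, `C₃ = A ⊗ A ⊗ A ⊗ A`. The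
formulas for the maps below on pure tensors are the lemmas whose names end in `_tmul`. -/

abbrev C₁ : Type v := A ⊗[K] A
abbrev C₂ : Type v := A ⊗[K] A ⊗[K] A
abbrev C₃ : Type v := A ⊗[K] A ⊗[K] A ⊗[K] A

/-- `(a₁, a₂, a₃) ↦ (a₂, a₃, a₁)`. -/
def cyc : C₂ K A →ₗ[K] C₂ K A :=
  (TensorProduct.comm K A (A ⊗[K] A)).toLinearMap ∘ₗ (TensorProduct.assoc K A A A).toLinearMap

@[simp] theorem cyc_tmul (a₁ a₂ a₃ : A) : cyc K A (a₁ ⊗ₜ a₂ ⊗ₜ a₃) = a₂ ⊗ₜ a₃ ⊗ₜ a₁ := by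
  simp [cyc]

/-- `(a₁, a₂, a₃) ↦ (a₂, a₁, a₃)`. -/
def swap₁₂ : C₂ K A →ₗ[K] C₂ K A :=
  (TensorProduct.comm K A A).toLinearMap.rTensor A

@[simp] theorem swap₁₂_tmul (a₁ a₂ a₃ : A) :
    swap₁₂ K A (a₁ ⊗ₜ a₂ ⊗ₜ a₃) = a₂ ⊗ₜ a₁ ⊗ₜ a₃ := by
  simp [swap₁₂]

/-- `(a₁, a₂, a₃, a₄) ↦ a₁ ⊗ (a₂, a₃, a₄)`. -/
def split₁ : C₃ K A ≃ₗ[K] A ⊗[K] C₂ K A :=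
  (TensorProduct.assoc K A A A).rTensor A ≪≫ₗ TensorProduct.assoc K A (A ⊗[K] A) A

@[simp] theorem split₁_tmul (a₁ a₂ a₃ a₄ : A) :
    split₁ K A (a₁ ⊗ₜ a₂ ⊗ₜ a₃ ⊗ₜ a₄) = a₁ ⊗ₜ (a₂ ⊗ₜ a₃ ⊗ₜ a₄) := by
  simp [split₁]

/-- `(a₁, a₂, a₃, a₄) ↦ (a₁, a₄, a₃, a₂)`. -/
def swap₂₄ : C₃ K A →ₗ[K] C₃ K A :=
  (split₁ K A).symm.toLinearMap ∘ₗ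
    (cyc K A ∘ₗ cyc K A ∘ₗ swap₁₂ K A).lTensor A ∘ₗ (split₁ K A).toLinearMap

@[simp] theorem swap₂₄_tmul (a₁ a₂ a₃ a₄ : A) :
    swap₂₄ K A (a₁ ⊗ₜ a₂ ⊗ₜ a₃ ⊗ₜ a₄) = a₁ ⊗ₜ a₄ ⊗ₜ a₃ ⊗ₜ a₂ := by
  simp [swap₂₄, LinearEquiv.symm_apply_eq]

end Permutations

section Complex

variable (K : Type u) [Field K] (A : Type v) [NonAssocRing A] [Module K A]
  [SMulCommClass K A A] [IsScalarTower K A A]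

/-- `(m, a) ↦ m a - a m`. -/
def b₁ : C₁ K A →ₗ[K] A :=
  LinearMap.mul' K A - LinearMap.mul' K A ∘ₗ (TensorProduct.comm K A A).toLinearMap

@[simp] theorem b₁_tmul (m a : A) : b₁ K A (m ⊗ₜ a) = m * a - a * m := by
  simp [b₁]

/-- `(m, a, b) ↦ (m a, b) - (m, a b) + (b m, a)`. -/
def b₂ : C₂ K A →ₗ[K] C₁ K A :=
  (LinearMap.mul' K A).rTensor A
    - (LinearMap.mul' K A).lTensor A ∘ₗ (TensorProduct.assoc K A A A).toLinearMap
    + (LinearMap.mul' K A).rTensor A ∘ₗ (TensorProduct.assoc K A A A).symm.toLinearMap ∘ₗ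
        (TensorProduct.comm K (A ⊗[K] A) A).toLinearMap

@[simp] theorem b₂_tmul (m a b : A) :
    b₂ K A (m ⊗ₜ a ⊗ₜ b) = (m * a) ⊗ₜ b - m ⊗ₜ (a * b) + (b * m) ⊗ₜ a := by
  simp [b₂]

/-- `(m, a, b, c) ↦ (m a, b, c) - (m, a b, c) + (m, a, b c) - (c m, a, b)`. -/
def b₃ : C₃ K A →ₗ[K] C₂ K A :=
  ((LinearMap.mul' K A).rTensor A).rTensor A
    - ((LinearMap.mul' K A).lTensor A ∘ₗ (TensorProduct.assoc K A A A).toLinearMap).rTensor A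
    + (LinearMap.mul' K A).lTensor (A ⊗[K] A) ∘ₗ
        (TensorProduct.assoc K (A ⊗[K] A) A A).toLinearMap
    - ((LinearMap.mul' K A).rTensor A ∘ₗ
          (TensorProduct.assoc K A A A).symm.toLinearMap).rTensor A ∘ₗ
        (TensorProduct.assoc K A (A ⊗[K] A) A).symm.toLinearMap ∘ₗ
        (TensorProduct.comm K (A ⊗[K] A ⊗[K] A) A).toLinearMap

@[simp] theorem b₃_tmul (m a b c : A) :
    b₃ K A (m ⊗ₜ a ⊗ₜ b ⊗ₜ c) =
      (m * a) ⊗ₜ b ⊗ₜ c - m ⊗ₜ (a * b) ⊗ₜ c + m ⊗ₜ a ⊗ₜ (b * c) - (c * m) ⊗ₜ a ⊗ₜ b := by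
  simp [b₃]

/-- `b₁^WA = b₁`. -/
abbrev b₁WA : C₁ K A →ₗ[K] A := b₁ K A

/-- `b₂^WA (a₁, a₂, a₃) = b₂ (a₁, a₂, a₃) + b₂ (a₂, a₃, a₁) - b₂ (a₂, a₁, a₃)`. -/
def b₂WA : C₂ K A →ₗ[K] C₁ K A :=
  b₂ K A + b₂ K A ∘ₗ cyc K A - b₂ K A ∘ₗ swap₁₂ K A

theorem b₂WA_tmul (a₁ a₂ a₃ : A) :
    b₂WA K A (a₁ ⊗ₜ a₂ ⊗ₜ a₃) =
      b₂ K A (a₁ ⊗ₜ a₂ ⊗ₜ a₃) + b₂ K A (a₂ ⊗ₜ a₃ ⊗ₜ a₁) - b₂ K A (a₂ ⊗ₜ a₁ ⊗ₜ a₃) := by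
  simp only [b₂WA, LinearMap.add_apply, LinearMap.sub_apply, LinearMap.comp_apply, cyc_tmul,
    swap₁₂_tmul]

/-- `b₃^WA (a₁, a₂, a₃, a₄) = b₃ (a₁, a₂, a₃, a₄) + b₃ (a₁, a₄, a₃, a₂)`. -/
def b₃WA : C₃ K A →ₗ[K] C₂ K A :=
  b₃ K A + b₃ K A ∘ₗ swap₂₄ K A

theorem b₃WA_tmul (a₁ a₂ a₃ a₄ : A) :
    b₃WA K A (a₁ ⊗ₜ a₂ ⊗ₜ a₃ ⊗ₜ a₄) =
      b₃ K A (a₁ ⊗ₜ a₂ ⊗ₜ a₃ ⊗ₜ a₄) + b₃ K A (a₁ ⊗ₜ a₄ ⊗ₜ a₃ ⊗ₜ a₂) := by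
  simp only [b₃WA, LinearMap.add_apply, LinearMap.comp_apply, swap₂₄_tmul]

/-- `D` is a chain complex of `K`-vector spaces that begins, up to isomorphism, with
`C₃ → C₂ → C₁ → C₀` and the boundaries `b₃^WA`, `b₂^WA`, `b₁^WA`. -/
def ExtendsWAComplex (D : ChainComplex (ModuleCat.{v} K) ℕ) : Prop :=
  ∃ (e₀ : D.X 0 ≃ₗ[K] A) (e₁ : D.X 1 ≃ₗ[K] C₁ K A) (e₂ : D.X 2 ≃ₗ[K] C₂ K A)
    (e₃ : D.X 3 ≃ₗ[K] C₃ K A),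
    (∀ x, e₀ (D.d 1 0 x) = b₁WA K A (e₁ x)) ∧
    (∀ x, e₁ (D.d 2 1 x) = b₂WA K A (e₂ x)) ∧
    (∀ x, e₂ (D.d 3 2 x) = b₃WA K A (e₃ x))

/-- Koszulness, in the sense of the homology complex above: for some choice of the higher terms,
the homology of the complex is trivial except in degree `0`. -/
def IsKoszul : Prop :=
  ∃ D : ChainComplex (ModuleCat.{v} K) ℕ, ExtendsWAComplex K A D ∧ ∀ n, 1 ≤ n → D.ExactAt n

end Complex

section GradedHomology

/-- For linear maps `f : L → M` and `g : M → N`, and subspaces `S` of `L` and `T` of `M`: the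
quotient of the cycles `ker g ∩ T` by the boundaries `f(S)` (those that lie in `ker g ∩ T`). -/
def HomologyPart {K : Type*} [Field K] {L M N : Type*} [AddCommGroup L] [Module K L]
    [AddCommGroup M] [Module K M] [AddCommGroup N] [Module K N]
    (f : L →ₗ[K] M) (g : M →ₗ[K] N) (S : Submodule K L) (T : Submodule K M) : Type _ :=
  ↥(LinearMap.ker g ⊓ T) ⧸ (S.map f).submoduleOf (LinearMap.ker g ⊓ T)

instance {K : Type*} [Field K] {L M N : Type*} [AddCommGroup L] [Module K L]
    [AddCommGroup M] [Module K M] [AddCommGroup N] [Module K N]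
    (f : L →ₗ[K] M) (g : M →ₗ[K] N) (S : Submodule K L) (T : Submodule K M) :
    AddCommGroup (HomologyPart f g S T) :=
  inferInstanceAs (AddCommGroup
    (↥(LinearMap.ker g ⊓ T) ⧸ (S.map f).submoduleOf (LinearMap.ker g ⊓ T)))

instance {K : Type*} [Field K] {L M N : Type*} [AddCommGroup L] [Module K L]
    [AddCommGroup M] [Module K M] [AddCommGroup N] [Module K N]
    (f : L →ₗ[K] M) (g : M →ₗ[K] N) (S : Submodule K L) (T : Submodule K M) :
    Module K (HomologyPart f g S T) :=
  inferInstanceAs (Module K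
    (↥(LinearMap.ker g ⊓ T) ⧸ (S.map f).submoduleOf (LinearMap.ker g ⊓ T)))

variable (K : Type u) [Field K] (X : Type v)

/-- The chains of degree `k` in `A ⊗ A`, where `A` is the free weakly associative algebra. -/
def C₁Part (k : ℕ) : Submodule K (C₁ K (FreeWA K X)) :=
  Submodule.span K {t | ∃ i₀ i₁, i₀ + i₁ = k ∧
    ∃ a₀ ∈ degreePart K X i₀, ∃ a₁ ∈ degreePart K X i₁, a₀ ⊗ₜ a₁ = t}

/-- The chains of degree `k` in `A ⊗ A ⊗ A`. -/
def C₂Part (k : ℕ) : Submodule K (C₂ K (FreeWA K X)) :=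
  Submodule.span K {t | ∃ i₀ i₁ i₂, i₀ + i₁ + i₂ = k ∧
    ∃ a₀ ∈ degreePart K X i₀, ∃ a₁ ∈ degreePart K X i₁, ∃ a₂ ∈ degreePart K X i₂,
      a₀ ⊗ₜ a₁ ⊗ₜ a₂ = t}

/-- The chains of degree `k` in `A ⊗ A ⊗ A ⊗ A`. -/
def C₃Part (k : ℕ) : Submodule K (C₃ K (FreeWA K X)) :=
  Submodule.span K {t | ∃ i₀ i₁ i₂ i₃, i₀ + i₁ + i₂ + i₃ = k ∧
    ∃ a₀ ∈ degreePart K X i₀, ∃ a₁ ∈ degreePart K X i₁, ∃ a₂ ∈ degreePart K X i₂,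
      ∃ a₃ ∈ degreePart K X i₃, a₀ ⊗ₜ a₁ ⊗ₜ a₂ ⊗ₜ a₃ = t}

/-- `H₀ = C₀ / Im b₁^WA`. -/
abbrev H₀ : Type (max u v) := FreeWA K X ⧸ LinearMap.range (b₁WA K (FreeWA K X))

/-- The component of degree `k` of the first homology space `ker b₁^WA / Im b₂^WA`. -/
abbrev H₁ (k : ℕ) : Type (max u v) :=
  HomologyPart (L := C₂ K (FreeWA K X)) (M := C₁ K (FreeWA K X)) (N := FreeWA K X)
    (b₂WA K (FreeWA K X)) (b₁WA K (FreeWA K X)) (C₂Part K X k) (C₁Part K X k)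

/-- The component of degree `k` of the second homology space `ker b₂^WA / Im b₃^WA`. -/
abbrev H₂ (k : ℕ) : Type (max u v) :=
  HomologyPart (L := C₃ K (FreeWA K X)) (M := C₂ K (FreeWA K X)) (N := C₁ K (FreeWA K X))
    (b₃WA K (FreeWA K X)) (b₂WA K (FreeWA K X)) (C₃Part K X k) (C₂Part K X k)

end GradedHomology

end WeakAssoc

end

/-! Expanding the three associators shows that weak associativity says exactly that every commutator
map `[a, -]` is a derivation. On one generator `X`, the derivation `[X, -]` kills `X`, hence every
word; then each `[a, -]` kills `X`, hence every word (`freeWA_mul_comm`). So `A` is commutative, and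
the whole computation lives on a commutative nonassociative algebra: `b₁ = 0`, `b₂` is symmetric in
its last two arguments, and the two extra terms of `b₂WA` cancel.

For `H₁`, the relation `m ⊗ ab ≡ ma ⊗ b + bm ⊗ a` modulo `Im b₂` reduces every tensor to the form
`m' ⊗ X`. That no further collapse occurs needs a well-defined map `m ⊗ a ↦ m'`. It comes from the
universal property applied to a commutative extension of `A` by `End A` (`EndExt`), with `X ↦ (X,
id)`. Hence the cokernel of `b₂` is `A` with degrees shifted by one (`rank_H₁_succ`), and the small
dimensions count commutative bracketed words.

For `H₂`, every linear map on `C₂` that is symmetric in the last two arguments kills `Im b₃WA`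
(`comp_b₃WA_eq_zero`), so symmetrised coefficient functionals detect classes. Conversely `b₃WA (m,
a, 1, 1) = m ⊗ 1 ⊗ a - m ⊗ a ⊗ 1` supplies all boundaries needed in degrees at most 2. The cycle `X
⊗ 1 ⊗ 1 - 1 ⊗ X ⊗ 1` is thus never a boundary, whatever the higher terms are, and `A` is not Koszul.
-/

noncomputable section

universe u v

namespace WeakAssoc

/-! ### Words, induction on them, and the grading -/

section Word

variable (K : Type u) [Field K] {X : Type v}

/-- The generator of the free weakly associative algebra attached to `x`. -/
def gen (x : X) : FreeWA K X := word K X (FreeMagma.of x : FreeMagma X)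

@[simp] theorem word_one : word K X 1 = 1 := by
  rw [word, map_one, map_one]

theorem word_mul (u w : WithOne (FreeMagma X)) : word K X (u * w) = word K X u * word K X w := by
  simp only [word, map_mul]

@[simp] theorem wordLength_one : wordLength (1 : WithOne (FreeMagma X)) = 0 := rfl

theorem wordLength_mul (u w : WithOne (FreeMagma X)) :
    wordLength (u * w) = wordLength u + wordLength w := by
  induction u with
  | one => simp
  | coe u =>
    induction w with
    | one => simp
    | coe w => rfl

/-- Induction on words along the product of the free unital magma. -/
theorem word_induction {P : WithOne (FreeMagma X) → Prop} (one : P 1)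
    (of : ∀ x : X, P (FreeMagma.of x : FreeMagma X)) (mul : ∀ u w, P u → P w → P (u * w))
    (w : WithOne (FreeMagma X)) : P w := by
  induction w with
  | one => exact one
  | coe w =>
    induction w with
    | ih1 x => exact of x
    | ih2 u w hu hw => exact mul u w hu hw

/-- The words span the free weakly associative algebra. -/
theorem freeWA_induction {P : FreeWA K X → Prop} (a : FreeWA K X)
    (zero : P 0) (add : ∀ a b, P a → P b → P (a + b)) (smul : ∀ (r : K) a, P a → P (r • a))
    (word : ∀ w, P (word K X w)) : P a := by
  obtain ⟨p, rfl⟩ := mk_surjective K X a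
  induction p using MonoidAlgebra.induction_linear with
  | zero => simpa using zero
  | add f g hf hg => simpa using add _ _ hf hg
  | single w r =>
    have : mk K X (MonoidAlgebra.single w r) = r • WeakAssoc.word K X w := by
      simp [WeakAssoc.word, smul_mk]
    rw [this]
    exact smul _ _ (word w)

theorem word_mem_degreePart (w : WithOne (FreeMagma X)) :
    word K X w ∈ degreePart K X (wordLength w) :=
  Submodule.subset_span ⟨w, rfl, rfl⟩

theorem one_mem_degreePart : (1 : FreeWA K X) ∈ degreePart K X 0 := by
  simpa using word_mem_degreePart K (1 : WithOne (FreeMagma X))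

theorem gen_mem_degreePart (x : X) : gen K x ∈ degreePart K X 1 :=
  word_mem_degreePart K ((FreeMagma.of x : FreeMagma X) : WithOne (FreeMagma X))

theorem mul_mem_degreePart {i j : ℕ} {a b : FreeWA K X} (ha : a ∈ degreePart K X i)
    (hb : b ∈ degreePart K X j) : a * b ∈ degreePart K X (i + j) := by
  induction ha using Submodule.span_induction with
  | zero => simp
  | add a a' _ _ h h' => rw [add_mul]; exact add_mem h h'
  | smul r a _ h => rw [smul_mul_assoc]; exact Submodule.smul_mem _ _ h
  | mem a ha =>
    obtain ⟨u, rfl, rfl⟩ := ha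
    induction hb using Submodule.span_induction with
    | zero => simp
    | add b b' _ _ h h' => rw [mul_add]; exact add_mem h h'
    | smul r b _ h => rw [mul_smul_comm]; exact Submodule.smul_mem _ _ h
    | mem b hb =>
      obtain ⟨w, rfl, rfl⟩ := hb
      rw [← word_mul, ← wordLength_mul]
      exact word_mem_degreePart K _

end Word

/-! ### Commutativity on one generator -/

section Commutative

/-- In a weakly associative algebra, the commutator with a fixed element is a derivation. -/
theorem IsWeaklyAssociative.commutator_mul {A : Type*} [NonUnitalNonAssocRing A]
    (h : IsWeaklyAssociative A) (a b c : A) :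
    a * (b * c) - b * c * a = (a * b - b * a) * c + b * (a * c - c * a) := by
  have := h a b c
  simp only [assoc] at this
  rw [← sub_eq_zero, ← this, sub_mul, mul_sub]
  abel

theorem isWeaklyAssociative_of_mul_comm {A : Type*} [NonUnitalNonAssocRing A]
    (h : ∀ a b : A, a * b = b * a) : IsWeaklyAssociative A := by
  intro a b c
  simp only [assoc]
  rw [h a c, h (b * c) a, h b a]
  abel

variable (K : Type u) [Field K]

/-- The commutator with `X` is a derivation that vanishes on `1` and on `X` itself, hence on every
word. -/
theorem gen_commute (a : FreeWA K Unit) : gen K () * a = a * gen K () := by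
  induction a using freeWA_induction with
  | zero => simp
  | add a b ha hb => rw [mul_add, add_mul, ha, hb]
  | smul r a ha => rw [mul_smul_comm, smul_mul_assoc, ha]
  | word w =>
    induction w using word_induction with
    | one => simp
    | of x => rfl
    | mul u w hu hw =>
      rw [word_mul, ← sub_eq_zero, (freeWA_isWeaklyAssociative K Unit).commutator_mul, hu, hw]
      simp

/-- The free weakly associative algebra on one generator is commutative. -/
theorem freeWA_mul_comm (a b : FreeWA K Unit) : a * b = b * a := by
  induction b using freeWA_induction with
  | zero => simp
  | add b c hb hc => rw [mul_add, add_mul, hb, hc]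
  | smul r b hb => rw [mul_smul_comm, smul_mul_assoc, hb]
  | word w =>
    induction w using word_induction with
    | one => simp
    -- The same derivation argument, now for arbitrary `a`; its base case is the centrality of `X`.
    | of x => exact (gen_commute K a).symm
    | mul u w hu hw =>
      rw [word_mul, ← sub_eq_zero, (freeWA_isWeaklyAssociative K Unit).commutator_mul, hu, hw]
      simp

end Commutative

/-! ### The universal property -/

section Lift

variable (K : Type u) [Field K] {X : Type v} {R : Type*} [NonAssocRing R] [Module K R]
  [IsScalarTower K R R] [SMulCommClass K R R]

/-- The value of a bracketed word under an assignment of its letters. -/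
def evalWord {M : Type*} [MulOneClass M] (f : X → M) : WithOne (FreeMagma X) →* M :=
  WithOne.lift (FreeMagma.lift f)

@[simp] theorem evalWord_of {M : Type*} [MulOneClass M] (f : X → M) (x : X) :
    evalWord f (FreeMagma.of x : FreeMagma X) = f x := by
  simp [evalWord]

/-- The homomorphism from the free nonassociative algebra attached to an assignment of letters. -/
def liftFree (f : X → R) : FreeNonAssoc K X →+* R :=
  let F := MonoidAlgebra.liftMagma K (A := R) (evalWord f).toMulHom
  { toFun := F
    map_zero' := map_zero F
    map_add' := map_add F
    map_mul' := map_mul F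
    map_one' := by simp [F, MonoidAlgebra.one_def] }

theorem liftFree_smul (f : X → R) (r : K) (p : FreeNonAssoc K X) :
    liftFree K f (r • p) = r • liftFree K f p :=
  map_smul (MonoidAlgebra.liftMagma K (A := R) (evalWord f).toMulHom) r p

theorem liftFree_of (f : X → R) (w : WithOne (FreeMagma X)) :
    liftFree K f (MonoidAlgebra.of K _ w) = evalWord f w := by
  change MonoidAlgebra.liftMagma K (A := R) (evalWord f).toMulHom _ = _
  simp

theorem ringConGen_rel_le_ker_liftFree (hR : IsWeaklyAssociative R) (f : X → R) :
    ringConGen (Rel K X) ≤ RingCon.ker (liftFree K f) := by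
  rw [RingCon.ringConGen_le]
  rintro p q ⟨a, b, c, rfl, rfl⟩
  rw [RingCon.ker_apply]
  simpa only [assoc, map_add, map_sub, map_mul, map_zero] using hR _ _ _

/-- The universal property of the free weakly associative algebra, as a linear map. -/
def lift (hR : IsWeaklyAssociative R) (f : X → R) : FreeWA K X →ₗ[K] R where
  toFun := RingCon.lift _ (liftFree K f) (ringConGen_rel_le_ker_liftFree K hR f)
  map_add' := map_add (RingCon.lift _ (liftFree K f) (ringConGen_rel_le_ker_liftFree K hR f))
  map_smul' r a := by
    obtain ⟨p, rfl⟩ := mk_surjective K X a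
    exact liftFree_smul K f r p

theorem lift_mul (hR : IsWeaklyAssociative R) (f : X → R) (a b : FreeWA K X) :
    lift K hR f (a * b) = lift K hR f a * lift K hR f b :=
  map_mul (RingCon.lift _ (liftFree K f) (ringConGen_rel_le_ker_liftFree K hR f)) a b

@[simp] theorem lift_one (hR : IsWeaklyAssociative R) (f : X → R) : lift K hR f 1 = 1 :=
  map_one (RingCon.lift _ (liftFree K f) (ringConGen_rel_le_ker_liftFree K hR f))

@[simp] theorem lift_word (hR : IsWeaklyAssociative R) (f : X → R) (w : WithOne (FreeMagma X)) :
    lift K hR f (word K X w) = evalWord f w :=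
  liftFree_of K f w

@[simp] theorem lift_gen (hR : IsWeaklyAssociative R) (f : X → R) (x : X) :
    lift K hR f (gen K x) = f x := by
  simp [gen]

end Lift

/-! ### The extension of `A` by `End A` and the maps `∂` -/

section Derivation

variable (K : Type u) [Field K] (A : Type v) [NonAssocRing A] [Module K A]

/-- The vector space `A ⊕ End A`, for the product
`(a, f) (b, g) = (a b, g ∘ (a ·) + f ∘ (b ·))`. -/
def EndExt : Type v := A × (A →ₗ[K] A)

namespace EndExt

instance : AddCommGroup (EndExt K A) := inferInstanceAs (AddCommGroup (A × (A →ₗ[K] A)))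

instance : Module K (EndExt K A) := inferInstanceAs (Module K (A × (A →ₗ[K] A)))

variable {K A}

/-- The pair `(a, f)`. -/
def mk (a : A) (f : A →ₗ[K] A) : EndExt K A := (a, f)

/-- The first component. -/
def fst : EndExt K A →ₗ[K] A := LinearMap.fst K A (A →ₗ[K] A)

/-- The second component. -/
def snd : EndExt K A →ₗ[K] A →ₗ[K] A := LinearMap.snd K A (A →ₗ[K] A)

@[simp] theorem fst_mk (a : A) (f : A →ₗ[K] A) : fst (mk a f) = a := rfl

@[simp] theorem snd_mk (a : A) (f : A →ₗ[K] A) : snd (mk a f) = f := rfl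

@[ext] theorem ext {x y : EndExt K A} (h₁ : fst x = fst y) (h₂ : ∀ m, snd x m = snd y m) :
    x = y :=
  Prod.ext h₁ (LinearMap.ext h₂)

instance : One (EndExt K A) := ⟨mk 1 0⟩

@[simp] theorem fst_one : fst (1 : EndExt K A) = 1 := rfl

@[simp] theorem snd_one : snd (1 : EndExt K A) = 0 := rfl

variable [IsScalarTower K A A]

instance : Mul (EndExt K A) :=
  ⟨fun x y => mk (fst x * fst y)
    (snd y ∘ₗ LinearMap.mulRight K (fst x) + snd x ∘ₗ LinearMap.mulRight K (fst y))⟩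

@[simp] theorem fst_mul (x y : EndExt K A) : fst (x * y) = fst x * fst y := rfl

@[simp] theorem snd_mul (x y : EndExt K A) (m : A) :
    snd (x * y) m = snd y (m * fst x) + snd x (m * fst y) := rfl

instance : NonAssocRing (EndExt K A) :=
  { (inferInstance : AddCommGroup (EndExt K A)) with
    mul := (· * ·)
    one := 1
    left_distrib := fun x y z => by
      ext
      · simp [mul_add]
      · simp [mul_add]; abel
    right_distrib := fun x y z => by
      ext
      · simp [add_mul]
      · simp [mul_add]; abel
    zero_mul := fun x => by ext <;> simp
    mul_zero := fun x => by ext <;> simp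
    one_mul := fun x => by ext <;> simp
    mul_one := fun x => by ext <;> simp }

/-- The product formula is symmetric in its two factors once `A` is commutative, and commutative
algebras are weakly associative. -/
theorem isWeaklyAssociative (h : ∀ a b : A, a * b = b * a) :
    IsWeaklyAssociative (EndExt K A) :=
  isWeaklyAssociative_of_mul_comm fun x y => by
    ext m
    · exact h _ _
    · simp [add_comm]

variable [SMulCommClass K A A]

instance : IsScalarTower K (EndExt K A) (EndExt K A) where
  smul_assoc r x y := by ext <;> simp [smul_mul_assoc, mul_smul_comm]

instance : SMulCommClass K (EndExt K A) (EndExt K A) where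
  smul_comm r x y := by ext <;> simp [mul_smul_comm]

end EndExt

/-- The homomorphism `a ↦ (a, ∂ a)` that sends the generator to `(X, id)`. -/
def liftEndExt : FreeWA K Unit →ₗ[K] EndExt K (FreeWA K Unit) :=
  lift K (EndExt.isWeaklyAssociative (freeWA_mul_comm K))
    fun _ => EndExt.mk (gen K ()) LinearMap.id

theorem liftEndExt_one : liftEndExt K 1 = 1 := lift_one K _ _

theorem liftEndExt_gen : liftEndExt K (gen K ()) = EndExt.mk (gen K ()) LinearMap.id :=
  lift_gen K _ _ _

theorem liftEndExt_mul (a b : FreeWA K Unit) :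
    liftEndExt K (a * b) = liftEndExt K a * liftEndExt K b := lift_mul K _ _ a b

theorem fst_liftEndExt (a : FreeWA K Unit) : EndExt.fst (liftEndExt K a) = a := by
  induction a using freeWA_induction with
  | zero => simp
  | add a b ha hb => simp [ha, hb]
  | smul r a ha => simp [ha]
  | word w =>
    induction w using word_induction with
    | one => simp [liftEndExt_one]
    | of x => exact congrArg EndExt.fst (liftEndExt_gen K)
    | mul u w hu hw => rw [word_mul, liftEndExt_mul, EndExt.fst_mul, hu, hw]

/-- The coefficient of `m ⊗ X` in the class of `m ⊗ a` modulo the image of `b₂`. -/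
def partialMul : FreeWA K Unit →ₗ[K] FreeWA K Unit →ₗ[K] FreeWA K Unit :=
  (EndExt.snd ∘ₗ liftEndExt K).flip

theorem partialMul_apply (m a : FreeWA K Unit) :
    partialMul K m a = EndExt.snd (liftEndExt K a) m := rfl

@[simp] theorem partialMul_one (m : FreeWA K Unit) : partialMul K m 1 = 0 := by
  simp [partialMul_apply, liftEndExt_one]

@[simp] theorem partialMul_gen (m : FreeWA K Unit) : partialMul K m (gen K ()) = m := by
  simp [partialMul_apply, liftEndExt_gen]

/-- The second component of the multiplicativity of `liftEndExt`. It is the relation imposed by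
`b₂`, read through `m ⊗ X ↦ m`; the product on `EndExt` is chosen to make it hold. -/
theorem partialMul_mul (m a b : FreeWA K Unit) :
    partialMul K m (a * b) = partialMul K (m * a) b + partialMul K (m * b) a := by
  simp only [partialMul_apply, liftEndExt_mul, EndExt.snd_mul, fst_liftEndExt]

end Derivation

/-! ### The boundaries over a commutative algebra -/

section CommutativeComplex

variable {K : Type u} [Field K] {A : Type v} [NonAssocRing A] [Module K A]
  [SMulCommClass K A A] [IsScalarTower K A A]

theorem b₁_eq_zero_of_mul_comm (h : ∀ a b : A, a * b = b * a) : b₁ K A = 0 := by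
  ext m a
  simp [h m a]

theorem b₂_tmul_symm (h : ∀ a b : A, a * b = b * a) (m a b : A) :
    b₂ K A (m ⊗ₜ a ⊗ₜ b) = b₂ K A (m ⊗ₜ b ⊗ₜ a) := by
  simp only [b₂_tmul, h a b, h b m, h a m]
  abel

/-- The cyclic and the transposed terms differ only by exchanging the last two arguments of `b₂`, so
they cancel. -/
theorem b₂WA_eq_b₂_of_mul_comm (h : ∀ a b : A, a * b = b * a) : b₂WA K A = b₂ K A := by
  refine TensorProduct.ext_threefold fun a b c => ?_
  rw [b₂WA_tmul, b₂_tmul_symm h b c a, add_sub_cancel_right]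

/-- A linear map on `A ⊗ A ⊗ A` that is symmetric in its last two arguments vanishes on the image
of `b₃^WA`, for commutative `A`. -/
theorem comp_b₃WA_eq_zero (h : ∀ a b : A, a * b = b * a) {V : Type*} [AddCommGroup V] [Module K V]
    (Φ : C₂ K A →ₗ[K] V) (hΦ : ∀ m a b, Φ (m ⊗ₜ a ⊗ₜ b) = Φ (m ⊗ₜ b ⊗ₜ a)) :
    Φ ∘ₗ b₃WA K A = 0 := by
  refine TensorProduct.ext_fourfold fun m a b c => ?_
  simp only [LinearMap.comp_apply, b₃WA_tmul, b₃_tmul, map_add, map_sub, LinearMap.zero_apply]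
  -- Each of the four terms for `(m, a, b, c)` becomes the negative of a term for `(m, c, b, a)`.
  rw [hΦ (m * a) b c, hΦ m (a * b) c, hΦ m a (b * c), hΦ (c * m) a b, h m a, h m c, h b a, h c b]
  abel

/-- These boundaries suffice in degrees at most 2: there a difference `m ⊗ a ⊗ b - m ⊗ b ⊗ a` of
basis tensors either vanishes or has a unit among its last two entries. -/
theorem b₃WA_tmul_one_one (h : ∀ a b : A, a * b = b * a) (m a : A) :
    b₃WA K A (m ⊗ₜ a ⊗ₜ 1 ⊗ₜ 1) = m ⊗ₜ 1 ⊗ₜ a - m ⊗ₜ a ⊗ₜ 1 := by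
  simp only [b₃WA_tmul, b₃_tmul, mul_one, one_mul, h m a]
  abel

end CommutativeComplex

/-! ### Computing the rank of a homology component -/

section Homology

/-- A linear map that induces an isomorphism from a homology space onto a subspace. -/
theorem rank_homologyPart_eq {K : Type*} [Field K] {L N : Type*} {M V : Type v}
    [AddCommGroup L] [Module K L] [AddCommGroup M] [Module K M] [AddCommGroup N] [Module K N]
    [AddCommGroup V] [Module K V] {f : L →ₗ[K] M} {g : M →ₗ[K] N} {S : Submodule K L}
    {T : Submodule K M} (φ : M →ₗ[K] V) (W : Submodule K V) (hf : φ ∘ₗ f = 0)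
    (hmem : ∀ t ∈ LinearMap.ker g ⊓ T, φ t ∈ W)
    (hsurj : ∀ w ∈ W, ∃ t ∈ LinearMap.ker g ⊓ T, φ t = w)
    (hker : ∀ t ∈ LinearMap.ker g ⊓ T, φ t = 0 → t ∈ S.map f) :
    Module.rank K (HomologyPart f g S T) = Module.rank K W := by
  let ψ : ↥(LinearMap.ker g ⊓ T) →ₗ[K] W := φ.restrict hmem
  have hψ : Function.Surjective ψ := by
    rintro ⟨w, hw⟩
    obtain ⟨t, ht, rfl⟩ := hsurj w hw
    exact ⟨⟨t, ht⟩, rfl⟩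
  have hk : (S.map f).submoduleOf (LinearMap.ker g ⊓ T) = LinearMap.ker ψ := by
    ext ⟨t, ht⟩
    rw [Submodule.submoduleOf, Submodule.mem_comap, LinearMap.mem_ker]
    constructor
    · rintro ⟨s, -, rfl⟩
      exact Subtype.ext (LinearMap.congr_fun hf s)
    · intro h
      exact hker t ht (congrArg Subtype.val h)
  exact ((Submodule.quotEquivOfEq _ _ hk).trans
    (ψ.quotKerEquivOfSurjective hψ)).rank_eq

theorem rank_homologyPart_eq_zero {K : Type*} [Field K] {L M N : Type*}
    [AddCommGroup L] [Module K L] [AddCommGroup M] [Module K M] [AddCommGroup N] [Module K N]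
    {f : L →ₗ[K] M} {g : M →ₗ[K] N} {S : Submodule K L} {T : Submodule K M}
    (h : ∀ t ∈ LinearMap.ker g ⊓ T, t ∈ S.map f) :
    Module.rank K (HomologyPart f g S T) = 0 := by
  rw [rank_homologyPart_eq (V := M) 0 ⊥ (by simp) (by simp) _ fun t ht _ => h t ht, rank_bot]
  rintro w rfl
  exact ⟨0, zero_mem _, rfl⟩

end Homology

/-! ### The first homology -/

section FirstHomology

variable (K : Type u) [Field K]

/-- The isomorphism of the cokernel of `b₂` with the algebra, `m ⊗ X ↦ m`. -/
def cokerMap : C₁ K (FreeWA K Unit) →ₗ[K] FreeWA K Unit := TensorProduct.lift (partialMul K)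

@[simp] theorem cokerMap_tmul (m a : FreeWA K Unit) :
    cokerMap K (m ⊗ₜ a) = partialMul K m a := rfl

theorem cokerMap_comp_b₂ : cokerMap K ∘ₗ b₂ K (FreeWA K Unit) = 0 := by
  refine TensorProduct.ext_threefold fun m a b => ?_
  simp [partialMul_mul, freeWA_mul_comm K b m]

variable {K} in
theorem tmul_mem_C₁Part {X : Type v} {i j k : ℕ} (h : i + j = k) {a b : FreeWA K X}
    (ha : a ∈ degreePart K X i) (hb : b ∈ degreePart K X j) : a ⊗ₜ b ∈ C₁Part K X k :=
  Submodule.subset_span ⟨i, j, h, a, ha, b, hb, rfl⟩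

variable {K} in
theorem tmul_mem_C₂Part {X : Type v} {i j l k : ℕ} (h : i + j + l = k) {a b c : FreeWA K X}
    (ha : a ∈ degreePart K X i) (hb : b ∈ degreePart K X j) (hc : c ∈ degreePart K X l) :
    a ⊗ₜ b ⊗ₜ c ∈ C₂Part K X k :=
  Submodule.subset_span ⟨i, j, l, h, a, ha, b, hb, c, hc, rfl⟩

variable {K} in
/-- A property of `C₁Part` that is closed under linear combinations may be checked on
`m ⊗ w` with a word `w`. -/
theorem C₁Part_le {X : Type v} {k : ℕ} {S : Submodule K (C₁ K (FreeWA K X))}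
    (h : ∀ i, ∀ m ∈ degreePart K X i, ∀ w, i + wordLength w = k → m ⊗ₜ word K X w ∈ S) :
    C₁Part K X k ≤ S := by
  refine Submodule.span_le.2 ?_
  rintro _ ⟨i, j, hij, m, hm, a, ha, rfl⟩
  have : degreePart K X j ≤ S.comap (TensorProduct.mk K _ _ m) := by
    refine Submodule.span_le.2 ?_
    rintro _ ⟨w, rfl, rfl⟩
    exact h i m hm w hij
  exact this ha

/-- The reduction of `m ⊗ w` to a multiple of `X`. The element `m` stays quantified inside the
induction because splitting `w = u v` multiplies it by `u` or by `v`. -/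
theorem tmul_word_sub_mem (w : WithOne (FreeMagma Unit)) :
    ∀ {i k : ℕ} {m : FreeWA K Unit}, m ∈ degreePart K Unit i → i + wordLength w = k →
      m ⊗ₜ word K Unit w - partialMul K m (word K Unit w) ⊗ₜ gen K () ∈
        (C₂Part K Unit k).map (b₂ K (FreeWA K Unit)) := by
  induction w using word_induction with
  | one =>
    intro i k m hm hk
    -- `b₂ (m, 1, 1) = m ⊗ 1`, while `∂ 1 = 0`.
    refine ⟨m ⊗ₜ 1 ⊗ₜ 1, tmul_mem_C₂Part (by simpa using hk) hm (one_mem_degreePart K)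
      (one_mem_degreePart K), ?_⟩
    simp
  | of x =>
    intro i k m hm hk
    have : partialMul K m (word K Unit (FreeMagma.of x : FreeMagma Unit)) = m := partialMul_gen K m
    rw [this]
    exact (sub_self (m ⊗ₜ[K] gen K ())) ▸ zero_mem _
  | mul u w hu hw =>
    intro i k m hm hk
    rw [wordLength_mul] at hk
    have h₁ := hu (k := k) (mul_mem_degreePart K hm (word_mem_degreePart K w)) (by omega)
    have h₂ := hw (k := k) (mul_mem_degreePart K hm (word_mem_degreePart K u)) (by omega)
    have h₃ : b₂ K (FreeWA K Unit) (m ⊗ₜ word K Unit u ⊗ₜ word K Unit w) ∈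
        (C₂Part K Unit k).map (b₂ K (FreeWA K Unit)) :=
      Submodule.mem_map_of_mem (tmul_mem_C₂Part (by omega) hm (word_mem_degreePart K u)
        (word_mem_degreePart K w))
    -- `m ⊗ uw = mu ⊗ w + wm ⊗ u - b₂ (m, u, w)`.
    convert sub_mem (add_mem h₁ h₂) h₃ using 1
    rw [word_mul, partialMul_mul, TensorProduct.add_tmul, b₂_tmul,
      freeWA_mul_comm K (word K Unit w) m]
    abel

theorem partialMul_word_mem (w : WithOne (FreeMagma Unit)) :
    ∀ {i k : ℕ} {m : FreeWA K Unit}, m ∈ degreePart K Unit i → i + wordLength w = k + 1 →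
      partialMul K m (word K Unit w) ∈ degreePart K Unit k := by
  induction w using word_induction with
  | one => simp
  | of x =>
    intro i k m hm hk
    have : partialMul K m (word K Unit (FreeMagma.of x : FreeMagma Unit)) = m := partialMul_gen K m
    rw [this]
    obtain rfl : i = k := Nat.succ_injective hk
    exact hm
  | mul u w hu hw =>
    intro i k m hm hk
    rw [wordLength_mul] at hk
    rw [word_mul, partialMul_mul]
    exact add_mem (hw (mul_mem_degreePart K hm (word_mem_degreePart K u)) (by omega))
      (hu (mul_mem_degreePart K hm (word_mem_degreePart K w)) (by omega))

theorem sub_cokerMap_mem {k : ℕ} {t : C₁ K (FreeWA K Unit)} (ht : t ∈ C₁Part K Unit k) :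
    t - cokerMap K t ⊗ₜ gen K () ∈ (C₂Part K Unit k).map (b₂ K (FreeWA K Unit)) := by
  have : C₁Part K Unit k ≤ ((C₂Part K Unit k).map (b₂ K (FreeWA K Unit))).comap
      (LinearMap.id - (TensorProduct.mk K _ _).flip (gen K ()) ∘ₗ cokerMap K) :=
    C₁Part_le fun i m hm w hw => tmul_word_sub_mem K w hm hw
  exact this ht

theorem cokerMap_mem {k : ℕ} {t : C₁ K (FreeWA K Unit)} (ht : t ∈ C₁Part K Unit (k + 1)) :
    cokerMap K t ∈ degreePart K Unit k := by
  have : C₁Part K Unit (k + 1) ≤ (degreePart K Unit k).comap (cokerMap K) :=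
    C₁Part_le fun i m hm w hw => partialMul_word_mem K w hm hw
  exact this ht

/-- All of `C₁` is cycles, and `cokerMap` identifies the quotient with `A`, with section `m ↦ m ⊗
X`; the removed factor `X` accounts for the shift from `k + 1` to `k`. -/
theorem rank_H₁_succ (k : ℕ) :
    Module.rank K (H₁ K Unit (k + 1)) = Module.rank K (degreePart K Unit k) := by
  have hb₁ := b₁_eq_zero_of_mul_comm (K := K) (freeWA_mul_comm K)
  have hb₂ := b₂WA_eq_b₂_of_mul_comm (K := K) (freeWA_mul_comm K)
  refine rank_homologyPart_eq (cokerMap K) _ (hb₂ ▸ cokerMap_comp_b₂ K)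
    (fun t ht => cokerMap_mem K ht.2) (fun m hm => ⟨m ⊗ₜ gen K (), ⟨?_, ?_⟩, ?_⟩) ?_
  · simp [b₁WA, hb₁]
  · exact tmul_mem_C₁Part rfl hm (gen_mem_degreePart K ())
  · simp
  · intro t ht h
    simpa [h, hb₂] using sub_cokerMap_mem K ht.2

theorem word_eq_one_of_length_eq_zero {X : Type v} {w : WithOne (FreeMagma X)}
    (h : wordLength w = 0) : w = 1 := by
  cases w with
  | one => rfl
  | coe w => exact absurd h w.length_pos.ne'

/-- In degree zero the only word is `1`, and `m ⊗ 1` is a boundary. -/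
theorem rank_H₁_zero : Module.rank K (H₁ K Unit 0) = 0 := by
  refine rank_homologyPart_eq_zero fun t ht => ?_
  rw [b₂WA_eq_b₂_of_mul_comm (freeWA_mul_comm K)]
  refine (C₁Part_le (S := (C₂Part K Unit 0).map (b₂ K (FreeWA K Unit))) ?_) ht.2
  intro i m hm w hw
  obtain ⟨rfl, hw⟩ := Nat.add_eq_zero_iff.1 hw
  obtain rfl := word_eq_one_of_length_eq_zero ((Nat.zero_add _).symm.trans hw)
  simpa using tmul_word_sub_mem K 1 hm (k := 0) rfl

end FirstHomology

/-! ### Dimensions of the components of degree at most 5 -/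

section LowDegree

theorem word_eq_of_length_eq_one {w : WithOne (FreeMagma Unit)} (h : wordLength w = 1) :
    w = (FreeMagma.of () : FreeMagma Unit) := by
  cases w with
  | one => exact absurd h (by simp)
  | coe w =>
    induction w using FreeMagma.recOnMul with
    | ih1 x => rfl
    | ih2 u v _ _ =>
      have hl : u.length + v.length = 1 := h
      have := u.length_pos
      have := v.length_pos
      omega

theorem exists_mul_of_length {X : Type v} {w : WithOne (FreeMagma X)} (h : 2 ≤ wordLength w) :
    ∃ u v, w = u * v ∧ 0 < wordLength u ∧ 0 < wordLength v := by
  cases w with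
  | one => exact absurd h (by simp)
  | coe w =>
    induction w using FreeMagma.recOnMul with
    | ih1 x => exact absurd h (show ¬ 2 ≤ 1 by omega)
    | ih2 u v _ _ => exact ⟨u, v, rfl, u.length_pos, v.length_pos⟩

variable (K : Type u) [Field K]

theorem word_length_one {w : WithOne (FreeMagma Unit)} (h : wordLength w = 1) :
    word K Unit w = gen K () := by
  rw [word_eq_of_length_eq_one h, gen]

theorem word_length_two {w : WithOne (FreeMagma Unit)} (h : wordLength w = 2) :
    word K Unit w = gen K () * gen K () := by
  obtain ⟨u, v, rfl, hu, hv⟩ := exists_mul_of_length h.ge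
  rw [wordLength_mul] at h
  rw [word_mul, word_length_one K (by omega : wordLength u = 1),
    word_length_one K (by omega : wordLength v = 1)]

theorem word_length_three {w : WithOne (FreeMagma Unit)} (h : wordLength w = 3) :
    word K Unit w = gen K () * (gen K () * gen K ()) := by
  obtain ⟨u, v, rfl, hu, hv⟩ := exists_mul_of_length (by omega : 2 ≤ wordLength w)
  rw [wordLength_mul] at h
  obtain h | h : wordLength u = 1 ∧ wordLength v = 2 ∨ wordLength u = 2 ∧ wordLength v = 1 := by
    omega
  · rw [word_mul, word_length_one K h.1, word_length_two K h.2]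
  · rw [word_mul, word_length_one K h.2, word_length_two K h.1, freeWA_mul_comm]

theorem word_length_four {w : WithOne (FreeMagma Unit)} (h : wordLength w = 4) :
    word K Unit w = gen K () * (gen K () * (gen K () * gen K ())) ∨
      word K Unit w = (gen K () * gen K ()) * (gen K () * gen K ()) := by
  obtain ⟨u, v, rfl, hu, hv⟩ := exists_mul_of_length (by omega : 2 ≤ wordLength w)
  rw [wordLength_mul] at h
  obtain h | h | h : wordLength u = 1 ∧ wordLength v = 3 ∨ wordLength u = 3 ∧ wordLength v = 1 ∨
      wordLength u = 2 ∧ wordLength v = 2 := by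
    omega
  · left; rw [word_mul, word_length_one K h.1, word_length_three K h.2]
  · left; rw [word_mul, word_length_one K h.2, word_length_three K h.1, freeWA_mul_comm]
  · right; rw [word_mul, word_length_two K h.1, word_length_two K h.2]

theorem word_length_five {w : WithOne (FreeMagma Unit)} (h : wordLength w = 5) :
    word K Unit w = gen K () * (gen K () * (gen K () * (gen K () * gen K ()))) ∨
      word K Unit w = gen K () * ((gen K () * gen K ()) * (gen K () * gen K ())) ∨
      word K Unit w = (gen K () * gen K ()) * (gen K () * (gen K () * gen K ())) := by
  obtain ⟨u, v, rfl, hu, hv⟩ := exists_mul_of_length (by omega : 2 ≤ wordLength w)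
  rw [wordLength_mul] at h
  obtain h | h | h | h : wordLength u = 1 ∧ wordLength v = 4 ∨ wordLength u = 4 ∧ wordLength v = 1 ∨
      wordLength u = 2 ∧ wordLength v = 3 ∨ wordLength u = 3 ∧ wordLength v = 2 := by
    omega
  · rw [word_mul, word_length_one K h.1]
    rcases word_length_four K h.2 with h | h <;> simp [h]
  · rw [word_mul, word_length_one K h.2, freeWA_mul_comm]
    rcases word_length_four K h.1 with h | h <;> simp [h]
  · right; right; rw [word_mul, word_length_two K h.1, word_length_three K h.2]
  · right; right; rw [word_mul, word_length_two K h.2, word_length_three K h.1, freeWA_mul_comm]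

/-- The natural numbers with the commutative nonassociative product `a² + b²`, which separates the
commutative bracketed words of small length. -/
@[ext] structure SumSq where
  /-- The underlying natural number. -/
  val : ℕ

instance : DecidableEq SumSq := fun _ _ => decidable_of_iff _ SumSq.ext_iff.symm

instance : DecidableEq (WithOne SumSq) := inferInstanceAs (DecidableEq (Option SumSq))

instance : Mul SumSq := ⟨fun a b => ⟨a.val ^ 2 + b.val ^ 2⟩⟩

theorem SumSq.mul_comm (a b : WithOne SumSq) : a * b = b * a := by
  cases a with
  | one => simp
  | coe a =>
    cases b with
    | one => simp
    | coe b => exact congrArg WithOne.coe (SumSq.ext (add_comm _ _))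

theorem monoidAlgebra_mul_comm {M : Type*} [MulOneClass M] (h : ∀ a b : M, a * b = b * a)
    (p q : MonoidAlgebra K M) : p * q = q * p := by
  induction p using MonoidAlgebra.induction_linear with
  | zero => simp
  | add f g hf hg => rw [add_mul, mul_add, hf, hg]
  | single a r =>
    induction q using MonoidAlgebra.induction_linear with
    | zero => simp
    | add f g hf hg => rw [add_mul, mul_add, hf, hg]
    | single b s => rw [MonoidAlgebra.single_mul_single, MonoidAlgebra.single_mul_single, h a b,
        mul_comm r s]

theorem evalWord_comp {X : Type*} {M N : Type*} [MulOneClass M] [MulOneClass N] (φ : M →* N)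
    (f : X → M) (w : WithOne (FreeMagma X)) : evalWord (φ ∘ f) w = φ (evalWord f w) := by
  induction w using word_induction with
  | one => simp
  | of x => simp
  | mul u w hu hw => simp only [map_mul, hu, hw]

/-- The algebra of a commutative unital magma `M` is commutative, so `A` maps to it; words with
distinct values in `M` go to distinct basis elements. -/
theorem linearIndependent_word {M : Type*} [MulOneClass M] (h : ∀ a b : M, a * b = b * a)
    {X : Type*} (f : X → M) {ι : Type*} (w : ι → WithOne (FreeMagma X))
    (hw : Function.Injective fun i => evalWord f (w i)) :
    LinearIndependent K fun i => word K X (w i) := by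
  have hR := isWeaklyAssociative_of_mul_comm (monoidAlgebra_mul_comm K h)
  refine LinearIndependent.of_comp ((MonoidAlgebra.coeffLinearEquiv K).toLinearMap ∘ₗ
    lift K hR (MonoidAlgebra.of K M ∘ f)) ?_
  convert (Finsupp.linearIndependent_single_one K M).comp _ hw using 1
  ext1 i
  simp only [Function.comp_apply, LinearMap.comp_apply, lift_word, evalWord_comp]
  simp

/-- `hcover` gives spanning and `hinj` independence. With letters evaluated to 1, the values are 26
and 8 in degree 4, and 677, 65, 29 in degree 5, so injectivity is decidable by computation. -/
theorem rank_degreePart_eq {k n : ℕ} (v : Fin n → WithOne (FreeMagma Unit))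
    (hlen : ∀ i, wordLength (v i) = k)
    (hcover : ∀ w, wordLength w = k → ∃ i, word K Unit w = word K Unit (v i))
    (hinj : ∀ i j, evalWord (fun _ => ((⟨1⟩ : SumSq) : WithOne SumSq)) (v i) =
      evalWord (fun _ => ((⟨1⟩ : SumSq) : WithOne SumSq)) (v j) → i = j) :
    Module.rank K (degreePart K Unit k) = n := by
  have hs : degreePart K Unit k = Submodule.span K (Set.range fun i => word K Unit (v i)) := by
    refine le_antisymm (Submodule.span_mono ?_) (Submodule.span_mono ?_)
    · rintro _ ⟨w, hw, rfl⟩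
      obtain ⟨i, hi⟩ := hcover w hw
      exact ⟨i, hi.symm⟩
    · rintro _ ⟨i, rfl⟩
      exact ⟨v i, hlen i, rfl⟩
  have : Module.Finite K (Submodule.span K (Set.range fun i => word K Unit (v i))) :=
    Module.Finite.span_of_finite K (Set.finite_range _)
  rw [hs, ← Module.finrank_eq_rank,
    finrank_span_eq_card (linearIndependent_word K SumSq.mul_comm _ v fun i j => hinj i j), Fintype.card_fin]

/-- The word that consists of the generator. -/
abbrev genWord : WithOne (FreeMagma Unit) := (FreeMagma.of () : FreeMagma Unit)

theorem rank_degreePart_zero : Module.rank K (degreePart K Unit 0) = 1 := by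
  rw [rank_degreePart_eq K ![1] (by decide) (fun w hw => ⟨0, ?_⟩) (by decide)]
  · simp
  · rw [word_eq_one_of_length_eq_zero hw]; rfl

theorem rank_degreePart_one : Module.rank K (degreePart K Unit 1) = 1 := by
  rw [rank_degreePart_eq K ![genWord] (by decide) (fun w hw => ⟨0, ?_⟩) (by decide)]
  · simp
  · rw [word_length_one K hw]; simp [gen]

theorem rank_degreePart_two : Module.rank K (degreePart K Unit 2) = 1 := by
  rw [rank_degreePart_eq K ![genWord * genWord] (by decide) (fun w hw => ⟨0, ?_⟩) (by decide)]
  · simp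
  · rw [word_length_two K hw]; simp [gen, word_mul]

theorem rank_degreePart_three : Module.rank K (degreePart K Unit 3) = 1 := by
  rw [rank_degreePart_eq K ![genWord * (genWord * genWord)] (by decide) (fun w hw => ⟨0, ?_⟩)
    (by decide)]
  · simp
  · rw [word_length_three K hw]; simp [gen, word_mul]

theorem rank_degreePart_four : Module.rank K (degreePart K Unit 4) = 2 := by
  rw [rank_degreePart_eq K ![genWord * (genWord * (genWord * genWord)),
    (genWord * genWord) * (genWord * genWord)] (by decide) (fun w hw => ?_) (by decide)]
  · simp
  · rcases word_length_four K hw with h | h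
    · exact ⟨0, by rw [h]; simp [gen, word_mul]⟩
    · exact ⟨1, by rw [h]; simp [gen, word_mul]⟩

theorem rank_degreePart_five : Module.rank K (degreePart K Unit 5) = 3 := by
  rw [rank_degreePart_eq K ![genWord * (genWord * (genWord * (genWord * genWord))),
    genWord * ((genWord * genWord) * (genWord * genWord)),
    (genWord * genWord) * (genWord * (genWord * genWord))] (by decide) (fun w hw => ?_) (by decide)]
  · simp
  · rcases word_length_five K hw with h | h | h
    · exact ⟨0, by rw [h]; simp [gen, word_mul]⟩
    · exact ⟨1, by rw [h]; simp [gen, word_mul]⟩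
    · exact ⟨2, by rw [h]; simp [gen, word_mul]⟩

end LowDegree


/-! ### The second homology in degrees at most 2, and failure of exactness -/

section SecondHomology

variable (K : Type u) [Field K]

/-- The coefficient of `Xⁿ` in the polynomial attached to an element of the free algebra. -/
def polyCoeff (n : ℕ) : FreeWA K Unit →ₗ[K] K :=
  Polynomial.lcoeff K n ∘ₗ
    lift K (isWeaklyAssociative_of_mul_comm (A := Polynomial K) mul_comm) fun _ => Polynomial.X

@[simp] theorem polyCoeff_one (n : ℕ) : polyCoeff K n 1 = if n = 0 then 1 else 0 := by
  simp [polyCoeff, Polynomial.coeff_one]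

@[simp] theorem polyCoeff_gen (n : ℕ) : polyCoeff K n (gen K ()) = if n = 1 then 1 else 0 := by
  simp [polyCoeff, Polynomial.coeff_X, eq_comm]

@[simp] theorem polyCoeff_gen_mul_gen (n : ℕ) :
    polyCoeff K n (gen K () * gen K ()) = if n = 2 then 1 else 0 := by
  simp [polyCoeff, lift_mul, ← pow_two, Polynomial.coeff_X_pow]

/-- The product of two coefficient functionals. -/
def polyCoeff₂ (i j : ℕ) : C₁ K (FreeWA K Unit) →ₗ[K] K :=
  LinearMap.mul' K K ∘ₗ TensorProduct.map (polyCoeff K i) (polyCoeff K j)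

@[simp] theorem polyCoeff₂_tmul (i j : ℕ) (a b : FreeWA K Unit) :
    polyCoeff₂ K i j (a ⊗ₜ b) = polyCoeff K i a * polyCoeff K j b := rfl

/-- The product of three coefficient functionals. -/
def polyCoeff₃ (i j l : ℕ) : C₂ K (FreeWA K Unit) →ₗ[K] K :=
  LinearMap.mul' K K ∘ₗ TensorProduct.map (polyCoeff₂ K i j) (polyCoeff K l)

@[simp] theorem polyCoeff₃_tmul (i j l : ℕ) (a b c : FreeWA K Unit) :
    polyCoeff₃ K i j l (a ⊗ₜ b ⊗ₜ c) = polyCoeff K i a * polyCoeff K j b * polyCoeff K l c := rfl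

theorem exists_smul_of_mem_degreePart {X : Type v} {k : ℕ} {x : FreeWA K X}
    (h : ∀ w, wordLength w = k → word K X w = x) {a : FreeWA K X} (ha : a ∈ degreePart K X k) :
    ∃ c : K, a = c • x := by
  have : degreePart K X k ≤ Submodule.span K {x} :=
    Submodule.span_mono (by rintro _ ⟨w, hw, rfl⟩; exact h w hw)
  obtain ⟨c, rfl⟩ := Submodule.mem_span_singleton.1 (this ha)
  exact ⟨c, rfl⟩

theorem exists_smul_of_mem_degreePart_zero {a : FreeWA K Unit} (ha : a ∈ degreePart K Unit 0) :
    ∃ c : K, a = c • (1 : FreeWA K Unit) :=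
  exists_smul_of_mem_degreePart K
    (fun w hw => by rw [word_eq_one_of_length_eq_zero hw, word_one]) ha

theorem exists_smul_of_mem_degreePart_one {a : FreeWA K Unit} (ha : a ∈ degreePart K Unit 1) :
    ∃ c : K, a = c • gen K () :=
  exists_smul_of_mem_degreePart K (fun _ => word_length_one K) ha

theorem exists_smul_of_mem_degreePart_two {a : FreeWA K Unit} (ha : a ∈ degreePart K Unit 2) :
    ∃ c : K, a = c • (gen K () * gen K ()) :=
  exists_smul_of_mem_degreePart K (fun _ => word_length_two K) ha

local notation "𝟏" => (1 : FreeWA K Unit)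
local notation "ξ" => gen K ()
local notation "ξ²" => (gen K () * gen K ())

theorem smul_tmul_smul_tmul_smul_mem {K : Type*} [Field K] {A : Type*} [AddCommGroup A]
    [Module K A] {S : Submodule K (A ⊗[K] A ⊗[K] A)} (r s t : K) {a b c : A}
    (h : a ⊗ₜ b ⊗ₜ c ∈ S) : (r • a) ⊗ₜ (s • b) ⊗ₜ (t • c) ∈ S := by
  rw [TensorProduct.smul_tmul_smul, TensorProduct.smul_tmul_smul]
  exact S.smul_mem _ h

theorem C₂Part_zero_le : C₂Part K Unit 0 ≤ Submodule.span K {𝟏 ⊗ₜ 𝟏 ⊗ₜ 𝟏} := by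
  refine Submodule.span_le.2 ?_
  rintro _ ⟨i, j, l, h, a, ha, b, hb, c, hc, rfl⟩
  obtain ⟨rfl, rfl, rfl⟩ : i = 0 ∧ j = 0 ∧ l = 0 := by omega
  obtain ⟨r, rfl⟩ := exists_smul_of_mem_degreePart_zero K ha
  obtain ⟨s, rfl⟩ := exists_smul_of_mem_degreePart_zero K hb
  obtain ⟨t, rfl⟩ := exists_smul_of_mem_degreePart_zero K hc
  exact smul_tmul_smul_tmul_smul_mem _ _ _ (Submodule.subset_span (by simp))

theorem C₂Part_one_le : C₂Part K Unit 1 ≤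
    Submodule.span K {ξ ⊗ₜ 𝟏 ⊗ₜ 𝟏, 𝟏 ⊗ₜ ξ ⊗ₜ 𝟏, 𝟏 ⊗ₜ 𝟏 ⊗ₜ ξ} := by
  refine Submodule.span_le.2 ?_
  rintro _ ⟨i, j, l, h, a, ha, b, hb, c, hc, rfl⟩
  obtain ⟨rfl, rfl, rfl⟩ | ⟨rfl, rfl, rfl⟩ | ⟨rfl, rfl, rfl⟩ :
      i = 1 ∧ j = 0 ∧ l = 0 ∨ i = 0 ∧ j = 1 ∧ l = 0 ∨ i = 0 ∧ j = 0 ∧ l = 1 := by omega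
  · obtain ⟨r, rfl⟩ := exists_smul_of_mem_degreePart_one K ha
    obtain ⟨s, rfl⟩ := exists_smul_of_mem_degreePart_zero K hb
    obtain ⟨t, rfl⟩ := exists_smul_of_mem_degreePart_zero K hc
    exact smul_tmul_smul_tmul_smul_mem _ _ _ (Submodule.subset_span (by simp))
  · obtain ⟨r, rfl⟩ := exists_smul_of_mem_degreePart_zero K ha
    obtain ⟨s, rfl⟩ := exists_smul_of_mem_degreePart_one K hb
    obtain ⟨t, rfl⟩ := exists_smul_of_mem_degreePart_zero K hc
    exact smul_tmul_smul_tmul_smul_mem _ _ _ (Submodule.subset_span (by simp))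
  · obtain ⟨r, rfl⟩ := exists_smul_of_mem_degreePart_zero K ha
    obtain ⟨s, rfl⟩ := exists_smul_of_mem_degreePart_zero K hb
    obtain ⟨t, rfl⟩ := exists_smul_of_mem_degreePart_one K hc
    exact smul_tmul_smul_tmul_smul_mem _ _ _ (Submodule.subset_span (by simp))

theorem C₂Part_two_le : C₂Part K Unit 2 ≤
    Submodule.span K {ξ² ⊗ₜ 𝟏 ⊗ₜ 𝟏, 𝟏 ⊗ₜ ξ² ⊗ₜ 𝟏, 𝟏 ⊗ₜ 𝟏 ⊗ₜ ξ², ξ ⊗ₜ ξ ⊗ₜ 𝟏, ξ ⊗ₜ 𝟏 ⊗ₜ ξ,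
      𝟏 ⊗ₜ ξ ⊗ₜ ξ} := by
  refine Submodule.span_le.2 ?_
  rintro _ ⟨i, j, l, h, a, ha, b, hb, c, hc, rfl⟩
  have key : (∃ r : K, a = r • 𝟏 ∧ i = 0 ∨ a = r • ξ ∧ i = 1 ∨ a = r • ξ² ∧ i = 2) ∧
      (∃ r : K, b = r • 𝟏 ∧ j = 0 ∨ b = r • ξ ∧ j = 1 ∨ b = r • ξ² ∧ j = 2) ∧
      (∃ r : K, c = r • 𝟏 ∧ l = 0 ∨ c = r • ξ ∧ l = 1 ∨ c = r • ξ² ∧ l = 2) := by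
    have (n : ℕ) (hn : n ≤ 2) (x : FreeWA K Unit) (hx : x ∈ degreePart K Unit n) :
        ∃ r : K, x = r • 𝟏 ∧ n = 0 ∨ x = r • ξ ∧ n = 1 ∨ x = r • ξ² ∧ n = 2 := by
      interval_cases n
      · simpa using exists_smul_of_mem_degreePart_zero K hx
      · simpa using exists_smul_of_mem_degreePart_one K hx
      · simpa using exists_smul_of_mem_degreePart_two K hx
    exact ⟨this i (by omega) a ha, this j (by omega) b hb, this l (by omega) c hc⟩
  obtain ⟨⟨r, hr⟩, ⟨s, hs⟩, ⟨t, ht⟩⟩ := key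
  -- Of the 27 choices of degrees, those with the wrong total are contradictory.
  rcases hr with ⟨rfl, rfl⟩ | ⟨rfl, rfl⟩ | ⟨rfl, rfl⟩ <;>
  rcases hs with ⟨rfl, rfl⟩ | ⟨rfl, rfl⟩ | ⟨rfl, rfl⟩ <;>
  rcases ht with ⟨rfl, rfl⟩ | ⟨rfl, rfl⟩ | ⟨rfl, rfl⟩ <;>
  first
  | omega
  | exact smul_tmul_smul_tmul_smul_mem _ _ _ (Submodule.subset_span (by simp))

theorem tmul_one_sub_mem {i j k : ℕ} (h : i + j = k) {m a : FreeWA K Unit}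
    (hm : m ∈ degreePart K Unit i) (ha : a ∈ degreePart K Unit j) :
    m ⊗ₜ a ⊗ₜ 𝟏 - m ⊗ₜ 𝟏 ⊗ₜ a ∈ (C₃Part K Unit k).map (b₃WA K (FreeWA K Unit)) := by
  rw [← neg_sub, ← b₃WA_tmul_one_one (freeWA_mul_comm K)]
  exact neg_mem (Submodule.mem_map_of_mem (Submodule.subset_span
    ⟨i, j, 0, 0, h, m, hm, a, ha, 1, one_mem_degreePart K, 1, one_mem_degreePart K, rfl⟩))

theorem rank_H₂_zero : Module.rank K (H₂ K Unit 0) = 0 := by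
  refine rank_homologyPart_eq_zero fun t ht => ?_
  obtain ⟨r, rfl⟩ := Submodule.mem_span_singleton.1 (C₂Part_zero_le K ht.2)
  have h : b₂WA K (FreeWA K Unit) _ = 0 := ht.1
  rw [b₂WA_eq_b₂_of_mul_comm (freeWA_mul_comm K)] at h
  have h := congrArg (polyCoeff₂ K 0 0) h
  obtain rfl : r = 0 := by simpa using h
  simp

/-- All three basis tensors have boundary `ξ ⊗ 1`, so cycles are the combinations of coefficient sum
zero. The boundaries form the line of `1 ⊗ ξ ⊗ 1 - 1 ⊗ 1 ⊗ ξ`, and the coefficient of `ξ ⊗ 1 ⊗ 1`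
detects the rest. -/
theorem rank_H₂_one : Module.rank K (H₂ K Unit 1) = 1 := by
  have hb₂ := b₂WA_eq_b₂_of_mul_comm (K := K) (freeWA_mul_comm K)
  have hX := gen_mem_degreePart K ()
  have h1 := one_mem_degreePart K (X := Unit)
  have hz₁ : ξ ⊗ₜ 𝟏 ⊗ₜ 𝟏 ∈ C₂Part K Unit 1 := tmul_mem_C₂Part (by norm_num) hX h1 h1
  have hz₂ : 𝟏 ⊗ₜ ξ ⊗ₜ 𝟏 ∈ C₂Part K Unit 1 := tmul_mem_C₂Part (by norm_num) h1 hX h1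
  rw [← Module.rank_self K, ← rank_top K K]
  refine rank_homologyPart_eq (polyCoeff₃ K 1 0 0) ⊤
    (comp_b₃WA_eq_zero (freeWA_mul_comm K) _ fun m a b => ?_) (fun _ _ => trivial)
    (fun w _ => ⟨w • (ξ ⊗ₜ 𝟏 ⊗ₜ 𝟏 - 𝟏 ⊗ₜ ξ ⊗ₜ 𝟏), Submodule.mem_inf.2 ⟨LinearMap.mem_ker.2 ?_, ?_⟩, ?_⟩) fun t ht h => ?_
  · simp only [polyCoeff₃_tmul]; ring
  · rw [hb₂]; simp
  · exact Submodule.smul_mem _ _ (Submodule.sub_mem _ hz₁ hz₂)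
  · simp
  · obtain ⟨c₁, _, ht', rfl⟩ := Submodule.mem_span_insert.1 (C₂Part_one_le K ht.2)
    obtain ⟨c₂, c₃, rfl⟩ := Submodule.mem_span_pair.1 ht'
    have hk : b₂WA K (FreeWA K Unit) _ = 0 := ht.1
    rw [hb₂] at hk
    have hk := congrArg (polyCoeff₂ K 1 0) hk
    simp at h hk
    obtain rfl := h
    obtain rfl : c₃ = -c₂ := by linear_combination hk
    convert Submodule.smul_mem _ c₂ (tmul_one_sub_mem K (k := 1) (by norm_num) h1 hX) using 1
    module

/-- `b₂` sends `1 ⊗ ξ ⊗ ξ` to `2 ξ ⊗ ξ - 1 ⊗ ξ²` and the other five basis tensors to `ξ² ⊗ 1`.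
Cycles thus have dimension 4, and exchanging the last two entries gives two independent boundaries.
The two functionals are the symmetrised coefficients of `ξ ⊗ ξ ⊗ 1` and `1 ⊗ ξ² ⊗ 1`. -/
theorem rank_H₂_two [CharZero K] : Module.rank K (H₂ K Unit 2) = 2 := by
  have hb₂ := b₂WA_eq_b₂_of_mul_comm (K := K) (freeWA_mul_comm K)
  have hX := gen_mem_degreePart K ()
  have h1 := one_mem_degreePart K (X := Unit)
  have hXX : ξ² ∈ degreePart K Unit 2 :=
    mul_mem_degreePart K (i := 1) (j := 1) hX hX
  have hz₁ : ξ ⊗ₜ ξ ⊗ₜ 𝟏 ∈ C₂Part K Unit 2 := tmul_mem_C₂Part (by norm_num) hX hX h1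
  have hz₂ : 𝟏 ⊗ₜ ξ² ⊗ₜ 𝟏 ∈ C₂Part K Unit 2 := tmul_mem_C₂Part (by norm_num) h1 hXX h1
  have hz₃ : ξ² ⊗ₜ 𝟏 ⊗ₜ 𝟏 ∈ C₂Part K Unit 2 := tmul_mem_C₂Part (by norm_num) hXX h1 h1
  have hr : Module.rank K (Fin 2 → K) = 2 := by simp
  rw [← hr, ← rank_top K (Fin 2 → K)]
  refine rank_homologyPart_eq (LinearMap.pi ![polyCoeff₃ K 1 1 0 + polyCoeff₃ K 1 0 1,
      polyCoeff₃ K 0 2 0 + polyCoeff₃ K 0 0 2]) ⊤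
    (comp_b₃WA_eq_zero (freeWA_mul_comm K) _ fun m a b => ?_) (fun _ _ => trivial)
    (fun w _ => ⟨w 0 • (ξ ⊗ₜ ξ ⊗ₜ 𝟏 - ξ² ⊗ₜ 𝟏 ⊗ₜ 𝟏) + w 1 • (𝟏 ⊗ₜ ξ² ⊗ₜ 𝟏 - ξ² ⊗ₜ 𝟏 ⊗ₜ 𝟏),
      Submodule.mem_inf.2 ⟨LinearMap.mem_ker.2 ?_, ?_⟩, ?_⟩) fun t ht h => ?_
  · ext i
    fin_cases i <;> simp <;> ring
  · rw [hb₂]; simp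
  · exact Submodule.add_mem _ (Submodule.smul_mem _ _ (Submodule.sub_mem _ hz₁ hz₃))
      (Submodule.smul_mem _ _ (Submodule.sub_mem _ hz₂ hz₃))
  · ext i
    fin_cases i <;> simp
  · obtain ⟨c₁, _, hs₁, rfl⟩ := Submodule.mem_span_insert.1 (C₂Part_two_le K ht.2)
    obtain ⟨c₂, _, hs₂, rfl⟩ := Submodule.mem_span_insert.1 hs₁
    obtain ⟨c₃, _, hs₃, rfl⟩ := Submodule.mem_span_insert.1 hs₂
    obtain ⟨c₄, _, hs₄, rfl⟩ := Submodule.mem_span_insert.1 hs₃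
    obtain ⟨c₅, c₆, rfl⟩ := Submodule.mem_span_pair.1 hs₄
    have hk : b₂WA K (FreeWA K Unit) _ = 0 := ht.1
    rw [hb₂] at hk
    -- This coefficient is `2 c₆`; characteristic zero gives `c₆ = 0`.
    have hk₁ := congrArg (polyCoeff₂ K 1 1) hk
    have hk₂ := congrArg (polyCoeff₂ K 2 0) hk
    have h₁ := congrFun h 0
    have h₂ := congrFun h 1
    simp at h₁ h₂ hk₁ hk₂
    obtain rfl := hk₁
    obtain rfl : c₃ = -c₂ := by linear_combination h₂
    obtain rfl : c₅ = -c₄ := by linear_combination h₁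
    obtain rfl : c₁ = 0 := by linear_combination hk₂
    -- What remains is antisymmetric in the last two entries.
    convert add_mem (Submodule.smul_mem _ c₂ (tmul_one_sub_mem K (k := 2) (by norm_num) h1 hXX))
      (Submodule.smul_mem _ c₄ (tmul_one_sub_mem K (k := 2) (by norm_num) hX hX)) using 1
    module

-- Exactness in degree 2 involves only `b₃WA` and `b₂WA`, so the higher terms play no role. The
-- obstruction is the cycle `z`, on which the symmetric functional `polyCoeff₃ K 1 0 0` takes the
-- value 1.
open CategoryTheory in
theorem not_exactAt_two (D : ChainComplex (ModuleCat.{u} K) ℕ)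
    (hD : ExtendsWAComplex K (FreeWA K Unit) D) : ¬ D.ExactAt 2 := by
  obtain ⟨e₀, e₁, e₂, e₃, -, h₂, h₃⟩ := hD
  rw [D.exactAt_iff' 3 2 1 (by simp) (by simp), ShortComplex.moduleCat_exact_iff]
  intro h
  let z : C₂ K (FreeWA K Unit) := ξ ⊗ₜ 𝟏 ⊗ₜ 𝟏 - 𝟏 ⊗ₜ ξ ⊗ₜ 𝟏
  have hz : b₂WA K (FreeWA K Unit) z = 0 := by
    rw [b₂WA_eq_b₂_of_mul_comm (freeWA_mul_comm K)]
    simp [z]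
  obtain ⟨y, hy⟩ := h (e₂.symm z) (e₁.injective (by
    refine (h₂ _).trans ?_
    rw [e₂.apply_symm_apply, hz]
    exact (map_zero e₁).symm))
  have hy' : b₃WA K (FreeWA K Unit) (e₃ y) = z := by
    refine (h₃ y).symm.trans ?_
    exact (congrArg e₂ hy).trans (e₂.apply_symm_apply z)
  have := LinearMap.congr_fun (comp_b₃WA_eq_zero (freeWA_mul_comm K) (polyCoeff₃ K 1 0 0)
    fun m a b => by simp only [polyCoeff₃_tmul]; ring) (e₃ y)
  rw [LinearMap.comp_apply, hy'] at this
  simp [z] at this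

end SecondHomology

end WeakAssoc
end

theorem mainTheorem11 (K : Type*) [Field K] [CharZero K] :
    -- on the free weakly associative algebra on one generator, the boundaries form a complex
    WeakAssoc.b₁WA K (WeakAssoc.FreeWA K Unit) ∘ₗ
        WeakAssoc.b₂WA K (WeakAssoc.FreeWA K Unit) = 0 ∧
    WeakAssoc.b₂WA K (WeakAssoc.FreeWA K Unit) ∘ₗ
        WeakAssoc.b₃WA K (WeakAssoc.FreeWA K Unit) = 0 ∧
    WeakAssoc.b₂WA K (WeakAssoc.FreeWA K Unit) = WeakAssoc.b₂ K (WeakAssoc.FreeWA K Unit) ∧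
    -- the projection of the algebra onto `H₀` is an isomorphism
    Function.Bijective
      (LinearMap.range (WeakAssoc.b₁WA K (WeakAssoc.FreeWA K Unit))).mkQ ∧
    -- the homogeneous components of `H₁`
    Module.rank K (WeakAssoc.H₁ K Unit 0) = 0 ∧
    Module.rank K (WeakAssoc.H₁ K Unit 1) = 1 ∧
    Module.rank K (WeakAssoc.H₁ K Unit 2) = 1 ∧
    Module.rank K (WeakAssoc.H₁ K Unit 3) = 1 ∧
    Module.rank K (WeakAssoc.H₁ K Unit 4) = 1 ∧
    Module.rank K (WeakAssoc.H₁ K Unit 5) = 2 ∧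
    Module.rank K (WeakAssoc.H₁ K Unit 6) = 3 ∧
    (∀ k : ℕ, Module.rank K (WeakAssoc.H₁ K Unit (k + 1)) =
      Module.rank K (WeakAssoc.degreePart K Unit k)) ∧
    -- the homogeneous components of `H₂`
    Module.rank K (WeakAssoc.H₂ K Unit 0) = 0 ∧
    Module.rank K (WeakAssoc.H₂ K Unit 1) = 1 ∧
    Module.rank K (WeakAssoc.H₂ K Unit 2) = 2 ∧
    -- no continuation of the complex is exact in degree `2`
    (∀ D, WeakAssoc.ExtendsWAComplex K (WeakAssoc.FreeWA K Unit) D → ¬ D.ExactAt 2) ∧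
    -- the algebra is not Koszul
    ¬ WeakAssoc.IsKoszul K (WeakAssoc.FreeWA K Unit) := by
  have hb₁ := WeakAssoc.b₁_eq_zero_of_mul_comm (K := K) (WeakAssoc.freeWA_mul_comm K)
  have hb₂ := WeakAssoc.b₂WA_eq_b₂_of_mul_comm (K := K) (WeakAssoc.freeWA_mul_comm K)
  refine ⟨?_, ?_, hb₂, ⟨?_, Submodule.mkQ_surjective _⟩, WeakAssoc.rank_H₁_zero K, ?_, ?_, ?_, ?_,
    ?_, ?_, WeakAssoc.rank_H₁_succ K, WeakAssoc.rank_H₂_zero K, WeakAssoc.rank_H₂_one K,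
    WeakAssoc.rank_H₂_two K, WeakAssoc.not_exactAt_two K, ?_⟩
  · rw [WeakAssoc.b₁WA, hb₁, LinearMap.zero_comp]
  · rw [hb₂]
    exact WeakAssoc.comp_b₃WA_eq_zero (WeakAssoc.freeWA_mul_comm K) _
      (WeakAssoc.b₂_tmul_symm (WeakAssoc.freeWA_mul_comm K))
  · rw [← LinearMap.ker_eq_bot, Submodule.ker_mkQ, WeakAssoc.b₁WA, hb₁, LinearMap.range_zero]
  · rw [WeakAssoc.rank_H₁_succ, WeakAssoc.rank_degreePart_zero]
  · rw [WeakAssoc.rank_H₁_succ, WeakAssoc.rank_degreePart_one]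
  · rw [WeakAssoc.rank_H₁_succ, WeakAssoc.rank_degreePart_two]
  · rw [WeakAssoc.rank_H₁_succ, WeakAssoc.rank_degreePart_three]
  · rw [WeakAssoc.rank_H₁_succ, WeakAssoc.rank_degreePart_four]
  · rw [WeakAssoc.rank_H₁_succ, WeakAssoc.rank_degreePart_five]
  · rintro ⟨D, hD, h⟩
    exact WeakAssoc.not_exactAt_two K D hD (h 2 one_le_two)
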